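/- Let $F_4$ be the field with four elements, $n\ge 1$, let $g_1,g_2\in F_4[x]$ divide $x^n-1$, and let $\nu\in F_4[x]$ have degree less than $n$. For $p\in F_4[x]$ let $[p]\in F_4^n$ be the vector of coefficients of $p \bmod (x^n-1)$. For polynomials $f_1,f_2,\mu$ let $\mathcal C(f_1,f_2,\mu)\subseteq F_4^{2n}$ be the quasi-cyclic code spanned by all words $([a\mu f_1],[af_1])$ and $([bf_2],[b\mu f_2])$ with $a,b\in F_4[x]$. Put $\bar\nu=\sum_{i=0}^{n-1}\nu_i^2x^{n-i}$ and $g_j^{\perp_h}=\sum_i h_{j,i}^2x^{\deg h_j-i}$, where $h_j=(x^n-1)/g_j=\sum_i h_{j,i}x^i$. Suppose that $\mathcal C=\mathcal C(g_1,g_2,\nu)$ has dimension $2n-\deg g_1-\deg g_2$ and $\mathcal C(g_1^{\perp_h},g_2^{\perp_h},-\bar\nu)$ has dimension $\deg g_1+\deg g_2$, or that $\gcd(\nu-1,x^n-1)=1$. Suppose further that $$g_1\mid(\nu\bar\nu+1)\,g_1^{\perp_h},\qquad g_2\mid(\nu\bar\nu+1)\,g_2^{\perp_h},\qquad g_2\mid(\nu+\bar\nu)\,g_1^{\perp_h}.$$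 (The first two conditions hold in particular if $g_1\mid g_1^{\perp_h}$ and $g_2\mid g_2^{\perp_h}$.) Then $2\deg g_1+2\deg g_2\le 2n$, the code $\mathcal C$ is nonzero, and, with $d$ the minimum Hamming weight of a nonzero word of $\mathcal C$, there is a binary quantum code $[[2n,\,2n-2\deg g_1-2\deg g_2,\,d]]$ that is pure to $d$. That is, there is a subspace $Q$ of $(\mathbb C^2)^{\otimes 2n}$ of dimension $2^{2n-2\deg g_1-2\deg g_2}$ such that every Pauli error of weight less than $d$ is detected by $Q$ and every Pauli error $E$ of weight $1,\dots,d-1$ satisfies $\langle\varphi,E\psi\rangle=0$ for all $\varphi,\psi\in Q$; moreover, $\langle\varphi,E\psi\rangle\neq0$ for some Pauli error $E$ of weight $d$ and some $\varphi,\psi\in Q$. -/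

import Mathlib

open Polynomial

noncomputable section

/-- The vector `[p]` of the coefficients, in ascending order, of the representative of degree `< n`
of the class of `p` in `F[X] / (X ^ n - 1)`. -/
def coeffVec {F : Type*} [Field F] (n : ℕ) (p : F[X]) : Fin n → F :=
  fun i => (p % (X ^ n - 1)).coeff i

/-- The word `([p], [q])` of length `2n`; the coordinates are indexed by two blocks of size `n`. -/
def word {F : Type*} [Field F] (n : ℕ) (p q : F[X]) : Fin n ⊕ Fin n → F :=
  Sum.elim (coeffVec n p) (coeffVec n q)

/-- The 2-generator quasi-cyclic code of length `2n` that is generated by `([ν g₁], [g₁])` and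
`([g₂], [ν g₂])`: the linear span of the words `([a ν g₁], [a g₁])` and `([b g₂], [b ν g₂])`. -/
def qcCode {F : Type*} [Field F] (n : ℕ) (g₁ g₂ ν : F[X]) : Submodule F (Fin n ⊕ Fin n → F) :=
  Submodule.span F
    (Set.range (fun a : F[X] => word n (a * (ν * g₁)) (a * g₁)) ∪
      Set.range (fun b : F[X] => word n (b * g₂) (b * (ν * g₂))))

/-- The Hermitian dual generator `∑ i, h_i² X ^ (deg h - i)`, the conjugate reciprocal polynomial of
the check polynomial `h = (X ^ n - 1) / g`. -/
def hermPerp {F : Type*} [Field F] (n : ℕ) (g : F[X]) : F[X] :=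
  ∑ i ∈ Finset.range (((X ^ n - 1) / g).natDegree + 1),
    C (((X ^ n - 1) / g).coeff i ^ 2) * X ^ (((X ^ n - 1) / g).natDegree - i)

/-- The conjugate transpose polynomial `∑_{i < n} f_i² X ^ (n - i)`, for `f` of degree `< n`. -/
def hermBar {F : Type*} [Field F] (n : ℕ) (f : F[X]) : F[X] :=
  ∑ i ∈ Finset.range n, C (f.coeff i ^ 2) * X ^ (n - i)

/-- The state space of `N` qubits, `(ℂ²)^{⊗ N}`, in coordinates with respect to the orthonormal
computational basis, which is indexed by the bit strings of length `N`. -/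
abbrev QubitSpace (N : ℕ) : Type := EuclideanSpace ℂ (Fin N → ZMod 2)

/-- The Pauli error `X(a) Z(b)`, which maps the basis vector `|x⟩` to `(-1)^{b·x} |x + a⟩`. -/
def pauli {N : ℕ} (a b : Fin N → ZMod 2) (ψ : QubitSpace N) : QubitSpace N :=
  WithLp.toLp 2 fun y => (-1 : ℂ) ^ (b ⬝ᵥ (y - a)).val * ψ (y - a)

/-- The number of qubits on which the Pauli error `X(a) Z(b)` acts nontrivially. -/
def pauliWeight {N : ℕ} (a b : Fin N → ZMod 2) : ℕ :=
  (Finset.univ.filter fun i => a i ≠ 0 ∨ b i ≠ 0).card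

/-- `Q` detects the Pauli error `X(a) Z(b)`: its compression to `Q` is a scalar. -/
def Detects {N : ℕ} (Q : Submodule ℂ (QubitSpace N)) (a b : Fin N → ZMod 2) : Prop :=
  ∃ c : ℂ, ∀ φ ∈ Q, ∀ ψ ∈ Q, inner ℂ φ (pauli a b ψ) = c * inner ℂ φ ψ

/-- `Q` is pure to `t`: the compression to `Q` of each Pauli error of weight `1, …, t - 1` is zero,
so that these errors map `Q` into its orthogonal complement. -/
def IsPureTo {N : ℕ} (Q : Submodule ℂ (QubitSpace N)) (t : ℕ) : Prop :=
  ∀ a b : Fin N → ZMod 2, 0 < pauliWeight a b → pauliWeight a b < t →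
    ∀ φ ∈ Q, ∀ ψ ∈ Q, inner ℂ φ (pauli a b ψ) = 0

/-- `Q` is an `[[N, k, d]]` quantum code that is pure to `d`: it has dimension `2 ^ k`, it detects
all errors on fewer than `d` qubits, and `d` is the largest number to which it is pure. -/
structure IsPureQuantumCode {N : ℕ} (Q : Submodule ℂ (QubitSpace N)) (k d : ℕ) : Prop where
  finrank_eq : Module.finrank ℂ Q = 2 ^ k
  detects : ∀ a b : Fin N → ZMod 2, pauliWeight a b < d → Detects Q a b
  pure : IsPureTo Q d
  not_pure : ¬ IsPureTo Q (d + 1)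

end

/-! The quantum code is the stabilizer code of the auxiliary quasi-cyclic code `S = C(g₁^⊥, g₂^⊥,
-ν̄)`, whose Hermitian dual turns out to be `C`.

On the classical side, the Hermitian product of two words is the constant coefficient of an
expression in `F[X] / (X ^ n - 1)`, with conjugation `X ↦ X⁻¹`, `a ↦ a²`. The conjugate of `g^⊥` is,
up to a power of `X`, the check polynomial of `g`, so its product with `p` vanishes exactly when `g
∣ p` (`cycMk_cycConj_hermPerp_mul_eq_zero_iff`). Hence `S` is orthogonal to `C`
(`qcCode_orthogonal`), and the three divisibility conditions make `S` self-orthogonal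
(`qcCode_hermPerp_self_orthogonal`). That `C` is the full dual of `S` follows by counting
dimensions, or by inverting `ν ^ 2 - 1 = (ν - 1) ^ 2` modulo `X ^ n - 1`
(`mem_qcCode_of_orthogonal`).

On the quantum side, words over `F` encode Pauli errors. The Hermitian product has two binary
coordinates: one decides commutation, the other vanishes where suitable phases turn the errors into
a genuine representation. Thus `S` acts on the qubit space. Nontrivial Pauli errors have trace zero,
so the fixed space has dimension `2 ^ N / |S|`. An error outside `C` anticommutes with some element
of `S` and sends the fixed space to its orthogonal complement; an error in `C` preserves it. So the
minimum weight of `C` is exactly the purity (`isPureQuantumCode_invariants`). -/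

/-! ### Signs and characters of bit strings. -/

/-- The sign `(-1) ^ x` of a bit `x`. -/
def bitSign (x : ZMod 2) : ℂ := (-1) ^ x.val

lemma bitSign_zero : bitSign 0 = 1 := by simp [bitSign]

lemma bitSign_one : bitSign 1 = -1 := by simp [bitSign, ZMod.val_one]

lemma zmod_two_cases (x : ZMod 2) : x = 0 ∨ x = 1 := by
  revert x; decide

lemma bitSign_add (x y : ZMod 2) : bitSign (x + y) = bitSign x * bitSign y := by
  have h : (1 + 1 : ZMod 2) = 0 := by decide
  rcases zmod_two_cases x with rfl | rfl <;> rcases zmod_two_cases y with rfl | rfl <;>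
    simp [bitSign_zero, bitSign_one, h]

lemma bitSign_mul_self (x : ZMod 2) : bitSign x * bitSign x = 1 := by
  rw [← bitSign_add, CharTwo.add_self_eq_zero, bitSign_zero]

lemma star_bitSign (x : ZMod 2) : (starRingEnd ℂ) (bitSign x) = bitSign x := by
  simp [bitSign]

lemma bitSign_sum {ι : Type*} (s : Finset ι) (f : ι → ZMod 2) :
    bitSign (∑ i ∈ s, f i) = ∏ i ∈ s, bitSign (f i) := by
  classical
  induction s using Finset.induction_on with
  | empty => simp [bitSign_zero]
  | insert i s hi ih => rw [Finset.sum_insert hi, Finset.prod_insert hi, bitSign_add, ih]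

/-- The sum of a nontrivial character of `ZMod 2 ^ N` over all bit strings vanishes. -/
lemma sum_bitSign_dotProduct {N : ℕ} {b : Fin N → ZMod 2} (hb : b ≠ 0) :
    ∑ y : Fin N → ZMod 2, bitSign (b ⬝ᵥ y) = 0 := by
  obtain ⟨i, hi⟩ := Function.ne_iff.mp hb
  have hi1 : b i = 1 := (zmod_two_cases (b i)).resolve_left hi
  have h : ∑ y : Fin N → ZMod 2, bitSign (b ⬝ᵥ y) =
      ∑ y : Fin N → ZMod 2, -bitSign (b ⬝ᵥ y) := by
    -- Translation by the unit vector at a coordinate where `b` is 1 flips every sign.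
    refine (Equiv.sum_comp (Equiv.addRight (Pi.single i 1)) _).symm.trans ?_
    refine Finset.sum_congr rfl fun y _ => ?_
    simp [dotProduct_add, bitSign_add, hi1, bitSign_one]
  rw [Finset.sum_neg_distrib] at h
  exact self_eq_neg.mp h

/-! ### Pauli errors and the stabilizer construction. -/

section Pauli

variable {N : ℕ}

lemma pauli_apply (a b : Fin N → ZMod 2) (ψ : QubitSpace N) (y : Fin N → ZMod 2) :
    pauli a b ψ y = bitSign (b ⬝ᵥ (y - a)) * ψ (y - a) := rfl

lemma pauli_zero (ψ : QubitSpace N) : pauli 0 0 ψ = ψ := by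
  ext y; simp [pauli_apply, bitSign_zero]

lemma pauli_pauli (a b a' b' : Fin N → ZMod 2) (ψ : QubitSpace N) :
    pauli a b (pauli a' b' ψ) = bitSign (b ⬝ᵥ a') • pauli (a + a') (b + b') ψ := by
  ext y
  have h : y - a = (y - (a + a')) + a' := by abel
  simp only [pauli_apply, PiLp.smul_apply, smul_eq_mul, sub_sub]
  rw [h, add_dotProduct, dotProduct_add, bitSign_add, bitSign_add]
  ring

/-- The Pauli error `X(a) Z(b)` as a linear map. -/
def pauliLin (t : (Fin N → ZMod 2) × (Fin N → ZMod 2)) : QubitSpace N →ₗ[ℂ] QubitSpace N where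
  toFun := pauli t.1 t.2
  map_add' x y := by ext; simp [pauli_apply, mul_add]
  map_smul' c x := by ext; simp [pauli_apply, mul_left_comm]

lemma pauliLin_apply (t : (Fin N → ZMod 2) × (Fin N → ZMod 2)) (ψ : QubitSpace N) :
    pauliLin t ψ = pauli t.1 t.2 ψ := rfl

lemma pauliLin_mul (s t : (Fin N → ZMod 2) × (Fin N → ZMod 2)) :
    pauliLin s * pauliLin t = bitSign (s.2 ⬝ᵥ t.1) • pauliLin (s + t) := by
  ext1 ψ
  exact pauli_pauli _ _ _ _ ψ

lemma inner_pauli_pauli (a b : Fin N → ZMod 2) (φ ψ : QubitSpace N) :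
    inner ℂ (pauli a b φ) (pauli a b ψ) = inner ℂ φ ψ := by
  simp only [PiLp.inner_apply, pauli_apply]
  rw [← Equiv.sum_comp (Equiv.subRight a) fun y => inner ℂ (φ y) (ψ y)]
  refine Finset.sum_congr rfl fun y _ => ?_
  simp only [RCLike.inner_apply, map_mul, star_bitSign, Equiv.subRight_apply]
  linear_combination (ψ (y - a) * (starRingEnd ℂ) (φ (y - a))) * bitSign_mul_self (b ⬝ᵥ (y - a))

/-- A nonzero shift `t.1` moves every basis vector, so the diagonal is zero; without a shift, the
trace is a sum over a nontrivial character. -/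
lemma trace_pauliLin {t : (Fin N → ZMod 2) × (Fin N → ZMod 2)} (ht : t ≠ 0) :
    LinearMap.trace ℂ (QubitSpace N) (pauliLin t) = 0 := by
  rw [LinearMap.trace_eq_sum_inner _ (EuclideanSpace.basisFun _ ℂ)]
  simp only [EuclideanSpace.basisFun_apply, EuclideanSpace.inner_single_left, map_one, one_mul,
    pauliLin_apply, pauli_apply]
  by_cases h1 : t.1 = 0
  · have h2 : t.2 ≠ 0 := fun h2 => ht (Prod.ext h1 h2)
    simpa [h1] using sum_bitSign_dotProduct h2
  · refine Finset.sum_eq_zero fun y _ => ?_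
    have : y - t.1 ≠ y := by simpa using h1
    simp [this]

/-- The symplectic form, with respect to which two Pauli errors are orthogonal if and only if they
commute. -/
def sympForm (s t : (Fin N → ZMod 2) × (Fin N → ZMod 2)) : ZMod 2 := s.1 ⬝ᵥ t.2 + s.2 ⬝ᵥ t.1

/-- The bilinear form whose sign is the cocycle of the Pauli errors, rescaled by `pauliPhase`
so that on each qubit they become the quaternion units. -/
def quatForm (s t : (Fin N → ZMod 2) × (Fin N → ZMod 2)) : ZMod 2 :=
  s.1 ⬝ᵥ t.1 + s.2 ⬝ᵥ t.2 + s.1 ⬝ᵥ t.2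

/-- The phase that turns a Pauli error into a tensor product of quaternion units. -/
def pauliPhase (t : (Fin N → ZMod 2) × (Fin N → ZMod 2)) : ℂ :=
  ∏ i, if t.1 i = t.2 i then 1 else Complex.I

lemma pauliPhase_zero : pauliPhase (0 : (Fin N → ZMod 2) × (Fin N → ZMod 2)) = 1 := by
  simp [pauliPhase]

lemma star_pauliPhase_mul_self (t : (Fin N → ZMod 2) × (Fin N → ZMod 2)) :
    (starRingEnd ℂ) (pauliPhase t) * pauliPhase t = 1 := by
  rw [pauliPhase, map_prod, ← Finset.prod_mul_distrib]
  refine Finset.prod_eq_one fun i _ => ?_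
  split_ifs <;> simp

/-- Both sides factor over the qubits, leaving the multiplication table of the quaternion units `1`,
`iX`, `iZ`, `XZ`. Where `quatForm` vanishes, the phases absorb the cocycle, so no choice of signs is
needed to obtain a representation. -/
lemma pauliPhase_mul (s t : (Fin N → ZMod 2) × (Fin N → ZMod 2)) :
    pauliPhase s * pauliPhase t * bitSign (s.2 ⬝ᵥ t.1) =
      bitSign (quatForm s t) * pauliPhase (s + t) := by
  simp only [pauliPhase, quatForm, dotProduct, bitSign_add, bitSign_sum,
    ← Finset.prod_mul_distrib]
  refine Finset.prod_congr rfl fun i _ => ?_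
  have h : (1 + 1 : ZMod 2) = 0 := by decide
  simp only [Prod.fst_add, Prod.snd_add, Pi.add_apply]
  rcases zmod_two_cases (s.1 i) with h1 | h1 <;> rcases zmod_two_cases (s.2 i) with h2 | h2 <;>
    rcases zmod_two_cases (t.1 i) with h3 | h3 <;> rcases zmod_two_cases (t.2 i) with h4 | h4 <;>
    simp [h1, h2, h3, h4, h, bitSign_zero, bitSign_one]

/-- The representation of a group of errors on which `quatForm` vanishes by tensor products of
quaternion units. -/
def pauliRep (T : AddSubgroup ((Fin N → ZMod 2) × (Fin N → ZMod 2)))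
    (hT : ∀ s ∈ T, ∀ t ∈ T, quatForm s t = 0) :
    Representation ℂ (Multiplicative T) (QubitSpace N) where
  toFun t := pauliPhase (t.toAdd : (Fin N → ZMod 2) × (Fin N → ZMod 2)) •
    pauliLin (t.toAdd : (Fin N → ZMod 2) × (Fin N → ZMod 2))
  map_one' := by
    ext1 ψ
    simp [pauliPhase_zero, pauliLin_apply, pauli_zero]
  map_mul' s t := by
    have h := pauliPhase_mul (s.toAdd : (Fin N → ZMod 2) × (Fin N → ZMod 2)) t.toAdd
    rw [hT _ s.toAdd.2 _ t.toAdd.2, bitSign_zero, one_mul] at h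
    rw [smul_mul_smul_comm, pauliLin_mul, smul_smul, h]
    rfl

/-- The dimension of the invariants is the average of the character, to which only the identity
contributes, with trace `2 ^ N`. -/
lemma natCard_mul_finrank_invariants (T : AddSubgroup ((Fin N → ZMod 2) × (Fin N → ZMod 2)))
    (hT : ∀ s ∈ T, ∀ t ∈ T, quatForm s t = 0) :
    Nat.card T * Module.finrank ℂ (pauliRep T hT).invariants = 2 ^ N := by
  have hc : (Nat.card (Multiplicative T) : ℂ) ≠ 0 := Nat.cast_ne_zero.mpr Nat.card_pos.ne'
  let _ := Fintype.ofFinite (Multiplicative T)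
  let _ := invertibleOfNonzero hc
  have h := (pauliRep T hT).card_inv_mul_sum_char_eq_finrank
  rw [Finset.sum_eq_single 1] at h
  · rw [Representation.char_one, finrank_euclideanSpace] at h
    rw [inv_mul_eq_iff_eq_mul₀ hc] at h
    have h2 : (Nat.card (Multiplicative T)) * Module.finrank ℂ (pauliRep T hT).invariants =
        Fintype.card (Fin N → ZMod 2) := by exact_mod_cast h.symm
    rwa [Fintype.card_pi_const, ZMod.card] at h2
  · intro t _ ht
    have ht0 : (t.toAdd : (Fin N → ZMod 2) × (Fin N → ZMod 2)) ≠ 0 := by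
      intro h0
      exact ht (Multiplicative.toAdd.injective (Subtype.ext h0))
    have h1 : pauliRep T hT t = pauliPhase (t.toAdd : (Fin N → ZMod 2) × (Fin N → ZMod 2)) •
        pauliLin (t.toAdd : (Fin N → ZMod 2) × (Fin N → ZMod 2)) := rfl
    rw [Representation.character, h1, map_smul, trace_pauliLin ht0, smul_zero]
  · simp

/-- Errors that anticommute with some element of `T` map the code to its orthogonal complement. -/
lemma inner_pauli_eq_zero (T : AddSubgroup ((Fin N → ZMod 2) × (Fin N → ZMod 2)))
    (hT : ∀ s ∈ T, ∀ t ∈ T, quatForm s t = 0) {e : (Fin N → ZMod 2) × (Fin N → ZMod 2)}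
    {t : (Fin N → ZMod 2) × (Fin N → ZMod 2)} (ht : t ∈ T) (het : sympForm t e ≠ 0)
    {φ ψ : QubitSpace N} (hφ : φ ∈ (pauliRep T hT).invariants)
    (hψ : ψ ∈ (pauliRep T hT).invariants) : inner ℂ φ (pauli e.1 e.2 ψ) = 0 := by
  have hφt : pauliPhase t • pauli t.1 t.2 φ = φ := hφ (Multiplicative.ofAdd ⟨t, ht⟩)
  have hψt : pauliPhase t • pauliLin t ψ = ψ := hψ (Multiplicative.ofAdd ⟨t, ht⟩)
  have hsgn : bitSign (t.2 ⬝ᵥ e.1) = - bitSign (e.2 ⬝ᵥ t.1) := by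
    have h1 : t.2 ⬝ᵥ e.1 = 1 + e.2 ⬝ᵥ t.1 := by
      have := (zmod_two_cases _).resolve_left het
      rw [sympForm, dotProduct_comm t.1] at this
      rw [← this, add_right_comm, CharTwo.add_self_eq_zero, zero_add]
    rw [h1, bitSign_add, bitSign_one, neg_one_mul]
  have hcomm : pauliLin t (pauliLin e ψ) = - pauliLin e (pauliLin t ψ) := by
    have h1 := LinearMap.congr_fun (pauliLin_mul t e) ψ
    have h2 := LinearMap.congr_fun (pauliLin_mul e t) ψ
    simp only [Module.End.mul_apply, LinearMap.smul_apply] at h1 h2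
    rw [h1, h2, hsgn, add_comm, neg_smul]
  -- Applying the unitary of `t`, which fixes `φ` and `ψ`, to both sides of the inner product
  -- changes its sign.
  have key : inner ℂ φ (pauliLin e ψ) = - inner ℂ φ (pauliLin e ψ) := by
    calc inner ℂ φ (pauliLin e ψ)
        = inner ℂ (pauliPhase t • pauli t.1 t.2 φ)
            (pauliPhase t • pauli t.1 t.2 (pauliLin e ψ)) := by
          rw [inner_smul_left, inner_smul_right, inner_pauli_pauli, ← mul_assoc,
            star_pauliPhase_mul_self, one_mul]
      _ = inner ℂ φ (- pauliLin e (pauliPhase t • pauliLin t ψ)) := by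
          rw [hφt, ← pauliLin_apply, hcomm, map_smul, smul_neg]
      _ = - inner ℂ φ (pauliLin e ψ) := by rw [hψt, inner_neg_right]
  exact self_eq_neg.mp key

/-- Errors that commute with all of `T` preserve the code. -/
lemma pauli_mem_invariants (T : AddSubgroup ((Fin N → ZMod 2) × (Fin N → ZMod 2)))
    (hT : ∀ s ∈ T, ∀ t ∈ T, quatForm s t = 0) {e : (Fin N → ZMod 2) × (Fin N → ZMod 2)}
    (he : ∀ t ∈ T, sympForm t e = 0) {ψ : QubitSpace N}
    (hψ : ψ ∈ (pauliRep T hT).invariants) :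
    pauli e.1 e.2 ψ ∈ (pauliRep T hT).invariants := by
  intro t
  obtain ⟨t, ht⟩ := t
  have hψt : pauliPhase t • pauliLin t ψ = ψ := hψ (Multiplicative.ofAdd ⟨t, ht⟩)
  have hsgn : t.2 ⬝ᵥ e.1 = e.2 ⬝ᵥ t.1 := by
    have := he t ht
    rw [sympForm, dotProduct_comm t.1] at this
    exact (CharTwo.add_eq_zero.mp this).symm
  have hcomm : pauliLin t (pauliLin e ψ) = pauliLin e (pauliLin t ψ) := by
    have h1 := LinearMap.congr_fun (pauliLin_mul t e) ψ
    have h2 := LinearMap.congr_fun (pauliLin_mul e t) ψ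
    simp only [Module.End.mul_apply, LinearMap.smul_apply] at h1 h2
    rw [h1, h2, hsgn, add_comm]
  change pauliPhase t • pauliLin t (pauliLin e ψ) = pauliLin e ψ
  rw [hcomm, ← map_smul, hψt]

/-- The stabilizer construction: let `T` be a group of `2 ^ r` errors on which `quatForm` vanishes,
so that they commute with each other. If `d` is the minimum weight of an error different from the
identity that commutes with `T`, then the space stabilized by `T` is an `[[N, N - r, d]]` quantum
code that is pure to `d`. -/
theorem isPureQuantumCode_invariants (T : AddSubgroup ((Fin N → ZMod 2) × (Fin N → ZMod 2)))
    (hT : ∀ s ∈ T, ∀ t ∈ T, quatForm s t = 0) {k r d : ℕ} (hr : Nat.card T = 2 ^ r)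
    (hk : k + r = N) (hd : 0 < d)
    (hmin : ∀ e : (Fin N → ZMod 2) × (Fin N → ZMod 2), e ≠ 0 → (∀ t ∈ T, sympForm t e = 0) →
      d ≤ pauliWeight e.1 e.2)
    (hex : ∃ e : (Fin N → ZMod 2) × (Fin N → ZMod 2), (∀ t ∈ T, sympForm t e = 0) ∧
      pauliWeight e.1 e.2 = d) :
    IsPureQuantumCode (pauliRep T hT).invariants k d := by
  have hfin : Module.finrank ℂ (pauliRep T hT).invariants = 2 ^ k := by
    have h := natCard_mul_finrank_invariants T hT
    have hN : 2 ^ N = 2 ^ k * 2 ^ r := by rw [← hk, pow_add]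
    rw [hr, hN, mul_comm] at h
    exact Nat.eq_of_mul_eq_mul_right (by positivity) h
  have hpure : IsPureTo (pauliRep T hT).invariants d := by
    intro a b hpos hlt φ hφ ψ hψ
    have hne : ((a, b) : (Fin N → ZMod 2) × (Fin N → ZMod 2)) ≠ 0 := by
      intro h0
      obtain ⟨rfl, rfl⟩ := Prod.mk.inj h0
      simp [pauliWeight] at hpos
    by_contra hinner
    refine (hmin (a, b) hne fun t ht => ?_).not_gt hlt
    by_contra het
    exact hinner (inner_pauli_eq_zero T hT ht het hφ hψ)
  refine ⟨hfin, fun a b hlt => ?_, hpure, fun hp => ?_⟩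
  · by_cases h0 : 0 < pauliWeight a b
    · exact ⟨0, fun φ hφ ψ hψ => by rw [hpure a b h0 hlt φ hφ ψ hψ, zero_mul]⟩
    · have h : ∀ i, a i = 0 ∧ b i = 0 := by
        simpa [pauliWeight, Finset.filter_eq_empty_iff] using h0
      obtain rfl : a = 0 := funext fun i => (h i).1
      obtain rfl : b = 0 := funext fun i => (h i).2
      exact ⟨1, fun φ _ ψ _ => by rw [pauli_zero, one_mul]⟩
  · obtain ⟨e, he, hw⟩ := hex
    have hQ : (pauliRep T hT).invariants ≠ ⊥ := by
      intro h
      rw [h, finrank_bot] at hfin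
      exact (pow_ne_zero k two_ne_zero) hfin.symm
    obtain ⟨ψ, hψ, hψ0⟩ := Submodule.exists_mem_ne_zero_of_ne_bot hQ
    -- Purity beyond `d` is tested on `ψ` and its own image under `e`, which also lies in the code;
    -- it would force `ψ` to have norm zero.
    have h := hp e.1 e.2 (by omega) (by omega) _ (pauli_mem_invariants T hT he hψ) ψ hψ
    rw [inner_pauli_pauli] at h
    exact hψ0 (inner_self_eq_zero.mp h)

end Pauli

/-! ### Hermitian codes over the field with four elements and their quantum codes. -/

section FieldWithFourElements

variable {F : Type*} [Field F] [Fintype F]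

lemma charP_two_of_card_eq_four (hF : Fintype.card F = 4) : CharP F 2 :=
  charP_of_card_eq_prime_pow (f := 2) (p := 2) (by rw [hF]; norm_num)

lemma pow_four_eq_self (hF : Fintype.card F = 4) (x : F) : x ^ 4 = x := by
  rw [← hF, FiniteField.pow_card]

/-- Any element other than 0 and 1 works, by the factorization `x ^ 4 - x = x (x - 1) (x ^ 2 + x +
1)`. -/
lemma exists_sq_add_self_add_one (hF : Fintype.card F = 4) : ∃ ω : F, ω ^ 2 + ω + 1 = 0 := by
  classical
  have := charP_two_of_card_eq_four hF
  obtain ⟨ω, hω⟩ : ∃ ω : F, ω ∉ ({0, 1} : Finset F) := by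
    by_contra! h
    have h1 := Finset.card_le_card (fun x _ => h x : (Finset.univ : Finset F) ⊆ {0, 1})
    rw [Finset.card_univ, hF] at h1
    exact absurd (h1.trans Finset.card_le_two) (by norm_num)
  simp only [Finset.mem_insert, Finset.mem_singleton, not_or] at hω
  refine ⟨ω, ?_⟩
  have h : ω * (ω - 1) * (ω ^ 2 + ω + 1) = 0 := by
    linear_combination pow_four_eq_self hF ω
  exact (mul_eq_zero.mp h).resolve_left (mul_ne_zero hω.1 (sub_ne_zero.mpr hω.2))

/-- Coordinates on a field with four elements in which its Hermitian form is given by the forms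
that govern the multiplication and the commutation of Pauli matrices. -/
lemma exists_addEquiv_field_four (hF : Fintype.card F = 4) :
    ∃ (e : ZMod 2 × ZMod 2 ≃+ F) (i : ZMod 2 →+* F) (ω : F),
      (∀ s t, e s * e t ^ 2 =
        i (s.1 * t.1 + s.2 * t.2 + s.1 * t.2) + i (s.1 * t.2 + s.2 * t.1) * ω) ∧
      ∀ x y, i x + i y * ω = 0 → x = 0 ∧ y = 0 := by
  have := charP_two_of_card_eq_four hF
  obtain ⟨ω, hω⟩ := exists_sq_add_self_add_one hF
  have h2 : (2 : F) = 0 := CharTwo.two_eq_zero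
  have hω0 : ω ≠ 0 := by rintro rfl; simp at hω
  have hω1 : 1 + ω ≠ 0 := by
    intro h
    have : (1 : F) = 0 := by linear_combination hω - ω * h
    exact one_ne_zero this
  let i : ZMod 2 →+* F := ZMod.castHom dvd_rfl F
  have hind : ∀ x y, i x + i y * ω = 0 → x = 0 ∧ y = 0 := by
    intro x y h
    rcases zmod_two_cases x with rfl | rfl <;> rcases zmod_two_cases y with rfl | rfl <;>
      simp_all
  -- In the basis `ω, ω²`, squaring swaps the basis vectors and `ω * ω² = 1`; expanding the
  -- Hermitian product in the basis `1, ω` then gives the two binary forms.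
  let f : ZMod 2 × ZMod 2 →+ F :=
    { toFun := fun s => i s.1 * ω + i s.2 * ω ^ 2
      map_zero' := by simp
      map_add' := fun s t => by simp only [Prod.fst_add, Prod.snd_add, map_add]; ring }
  have hf : ∀ s, f s = i s.1 * ω + i s.2 * ω ^ 2 := fun _ => rfl
  have hinj : Function.Injective f := by
    rw [injective_iff_map_eq_zero]
    intro s hs
    have h : ω * (i s.1 + i s.2 * ω) = 0 := by rw [← hs, hf]; ring
    have h' := hind _ _ ((mul_eq_zero.mp h).resolve_left hω0)
    exact Prod.ext h'.1 h'.2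
  have hbij : Function.Bijective f := by
    rw [Fintype.bijective_iff_injective_and_card]
    exact ⟨hinj, by rw [hF]; rfl⟩
  have hi : ∀ x, i x ^ 2 = i x := by
    intro x
    rcases zmod_two_cases x with rfl | rfl <;> simp
  refine ⟨AddEquiv.ofBijective f hbij, i, ω, fun s t => ?_, hind⟩
  change f s * f t ^ 2 = _
  have ht : f t ^ 2 = i t.1 * ω ^ 2 + i t.2 * ω := by
    rw [hf]
    linear_combination ω ^ 2 * hi t.1 + ω ^ 4 * hi t.2 + i t.1 * i t.2 * ω ^ 3 * h2 +
      i t.2 * (ω ^ 2 - ω) * hω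
  rw [ht, hf]
  simp only [map_add, map_mul]
  linear_combination (i s.1 * i t.1 * (ω - 1) + i s.2 * i t.2 * (ω - 1) + i s.1 * i t.2 +
    i s.2 * i t.1 * (ω ^ 2 - ω)) * hω - i s.1 * i t.2 * (ω + 1) * h2

/-- The quantum code of a Hermitian self-orthogonal linear code `S` over the field with four
elements: if `C` is the Hermitian dual of `S`, and `d` its minimum weight, then there is a quantum
code with parameters `[[N, N - 2 dim S, d]]` that is pure to `d`. -/
theorem exists_isPureQuantumCode [DecidableEq F] (hF : Fintype.card F = 4) {I : Type*} [Fintype I]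
    {N : ℕ} (hI : Fintype.card I = N) (S C : Submodule F (I → F))
    (hS : ∀ s ∈ S, ∀ t ∈ S, ∑ j, s j * t j ^ 2 = 0)
    (hC : ∀ w, w ∈ C ↔ ∀ s ∈ S, ∑ j, s j * w j ^ 2 = 0) {k d : ℕ}
    (hk : k + 2 * Module.finrank F S = N)
    (hd : IsLeast {w : ℕ | ∃ c ∈ C, c ≠ 0 ∧ hammingNorm c = w} d) :
    ∃ Q : Submodule ℂ (QubitSpace N), IsPureQuantumCode Q k d := by
  obtain ⟨e, i, ω, he, hind⟩ := exists_addEquiv_field_four hF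
  obtain ⟨σ⟩ : Nonempty (I ≃ Fin N) := ⟨Fintype.equivFinOfCardEq hI⟩
  let E : ((Fin N → ZMod 2) × (Fin N → ZMod 2)) →+ (I → F) :=
    { toFun := fun s j => e (s.1 (σ j), s.2 (σ j))
      map_zero' := funext fun j => e.map_zero
      map_add' := fun s t => funext fun j =>
        e.map_add (s.1 (σ j), s.2 (σ j)) (t.1 (σ j), t.2 (σ j)) }
  have hEapp : ∀ s j, E s j = e (s.1 (σ j), s.2 (σ j)) := fun _ _ => rfl
  have hEinj : Function.Injective E := by
    intro s t h
    have h1 : ∀ l, (s.1 l, s.2 l) = (t.1 l, t.2 l) := fun l => by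
      have := congrFun h (σ.symm l)
      rw [hEapp, hEapp, σ.apply_symm_apply] at this
      exact e.injective this
    exact Prod.ext (funext fun l => congrArg Prod.fst (h1 l))
      (funext fun l => congrArg Prod.snd (h1 l))
  have hEsurj : Function.Surjective E := by
    intro w
    refine ⟨(fun l => (e.symm (w (σ.symm l))).1, fun l => (e.symm (w (σ.symm l))).2),
      funext fun j => ?_⟩
    simp [hEapp]
  have hform : ∀ s t, ∑ j, E s j * E t j ^ 2 = i (quatForm s t) + i (sympForm s t) * ω := by
    intro s t
    simp only [hEapp, he, quatForm, sympForm, dotProduct, ← Finset.sum_add_distrib, map_sum,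
      Finset.sum_mul]
    exact Equiv.sum_comp σ fun l => i (s.1 l * t.1 l + s.2 l * t.2 l + s.1 l * t.2 l) +
      i (s.1 l * t.2 l + s.2 l * t.1 l) * ω
  have hweight : ∀ s, hammingNorm (E s) = pauliWeight s.1 s.2 := by
    intro s
    refine Finset.card_equiv σ fun j => ?_
    simp only [Finset.mem_filter, Finset.mem_univ, true_and, hEapp, ne_eq,
      EmbeddingLike.map_eq_zero_iff, Prod.mk_eq_zero, not_and_or]
  let T : AddSubgroup ((Fin N → ZMod 2) × (Fin N → ZMod 2)) := S.toAddSubgroup.comap E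
  have hT : ∀ s ∈ T, ∀ t ∈ T, quatForm s t = 0 := fun s hs t ht =>
    (hind _ _ ((hform s t).symm.trans (hS _ hs _ ht))).1
  have hcard : Nat.card T = 2 ^ (2 * Module.finrank F S) := by
    have h : Nat.card T = Nat.card S :=
      Nat.card_congr ((Equiv.ofBijective E ⟨hEinj, hEsurj⟩).subtypeEquiv fun _ => Iff.rfl)
    rw [h, Module.natCard_eq_pow_finrank (K := F), Nat.card_eq_fintype_card, hF, pow_mul]
    norm_num
  have hTC : ∀ s, (∀ t ∈ T, sympForm t s = 0) ↔ E s ∈ C := by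
    intro s
    rw [hC]
    refine ⟨fun h w hw => ?_, fun h t ht => (hind _ _ ((hform t s).symm.trans (h _ ht))).2⟩
    obtain ⟨t, rfl⟩ := hEsurj w
    -- Commutation kills only the `ω`-coordinate of the product, leaving it in the prime field. As
    -- `S` is linear over `F`, the product times `ω` is in the prime field too, so it is zero.
    obtain ⟨t', ht'⟩ := hEsurj (ω • E t)
    have h1 := hform t s
    have h2 := hform t' s
    rw [h t hw, map_zero, zero_mul, add_zero] at h1
    rw [h t' (by change E t' ∈ S; rw [ht']; exact S.smul_mem _ hw), map_zero, zero_mul,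
      add_zero, ht'] at h2
    simp only [Pi.smul_apply, smul_eq_mul, mul_assoc] at h2
    rw [← Finset.mul_sum, h1] at h2
    have h3 := hind (-quatForm t' s) (quatForm t s) (by rw [map_neg]; linear_combination h2)
    rw [h1, h3.2, map_zero]
  refine ⟨_, isPureQuantumCode_invariants T hT hcard hk ?_ (fun s hs0 hs => ?_) ?_⟩
  · obtain ⟨c, -, hc0, rfl⟩ := hd.1
    exact hammingNorm_pos_iff.mpr hc0
  · refine hd.2 ⟨E s, (hTC s).mp hs, fun h => hs0 (hEinj (h.trans (map_zero E).symm)), hweight s⟩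
  · obtain ⟨c, hc, -, hw⟩ := hd.1
    obtain ⟨s, rfl⟩ := hEsurj c
    exact ⟨s, (hTC s).mpr hc, (hweight s).symm.trans hw⟩

/-- Two codes that are orthogonal for the Hermitian form are dual to each other if and only if
their dimensions add up to the length. -/
lemma hermitian_dual_iff_finrank (hF : Fintype.card F = 4) {I : Type*} [Fintype I]
    {S C : Submodule F (I → F)} (hSC : ∀ s ∈ S, ∀ c ∈ C, ∑ j, s j * c j ^ 2 = 0) :
    (∀ w : I → F, (∀ s ∈ S, ∑ j, s j * w j ^ 2 = 0) → w ∈ C) ↔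
      Module.finrank F C + Module.finrank F S = Fintype.card I := by
  classical
  have := charP_two_of_card_eq_four hF
  let D : Submodule F (I → F) :=
    (S.map (dotProductEquiv F I).toLinearMap).dualCoannihilator
  have hD : ∀ w, w ∈ D ↔ ∀ s ∈ S, ∑ j, s j * w j = 0 := by
    intro w
    simp only [D, Submodule.mem_dualCoannihilator, Submodule.mem_map]
    constructor
    · intro h s hs
      exact h _ ⟨s, hs, rfl⟩
    · rintro h _ ⟨s, hs, rfl⟩
      exact h s hs
  have hfin : Module.finrank F S + Module.finrank F D = Fintype.card I := by
    have h := Subspace.finrank_add_finrank_dualCoannihilator_eq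
      (S.map (dotProductEquiv F I).toLinearMap)
    rwa [LinearEquiv.finrank_map_eq, Module.finrank_fintype_fun_eq_card] at h
  have hsq : Function.Injective fun x : F => x ^ 2 := frobenius_inj F 2
  -- Coordinatewise squaring turns Hermitian into bilinear orthogonality. It is only semilinear, so
  -- cardinalities are compared instead of dimensions; its surjectivity says that `C` contains the
  -- whole Hermitian dual of `S`.
  let f : C → D := fun c => ⟨fun j => c.1 j ^ 2, (hD _).mpr fun s hs => hSC s hs c c.2⟩
  have hf : Function.Injective f := fun c c' h => Subtype.ext (funext fun j =>
    hsq (congrFun (congrArg Subtype.val h) j))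
  have hcard : Nat.card C = Nat.card D ↔ Module.finrank F C = Module.finrank F D := by
    rw [Module.natCard_eq_pow_finrank (K := F), Module.natCard_eq_pow_finrank (K := F) (V := D)]
    exact Nat.pow_right_injective (by rw [Nat.card_eq_fintype_card, hF]; norm_num) |>.eq_iff
  have hbij : Function.Bijective f ↔ Module.finrank F C = Module.finrank F D := by
    rw [← hcard, Nat.bijective_iff_injective_and_card]
    exact and_iff_right hf
  rw [← hfin, add_comm, add_right_inj, ← hbij]
  constructor
  · refine fun h => ⟨hf, fun ⟨w, hw⟩ => ?_⟩
    have hw4 : ∀ j, (w j ^ 2) ^ 2 = w j := fun j => by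
      rw [← pow_mul]; exact pow_four_eq_self hF _
    refine ⟨⟨fun j => w j ^ 2, h _ fun s hs => ?_⟩, Subtype.ext (funext hw4)⟩
    simp only [hw4]
    exact (hD w).mp hw s hs
  · intro h w hw
    obtain ⟨c, hc⟩ := h.2 ⟨fun j => w j ^ 2, (hD _).mpr hw⟩
    have : w = c := funext fun j => hsq (congrFun (congrArg Subtype.val hc) j).symm
    rw [this]
    exact c.2

end FieldWithFourElements

/-! ### Coefficient vectors modulo `X ^ n - 1` and dimensions of quasi-cyclic codes. -/

section Cyclic

variable {F : Type*} [Field F]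

lemma degree_mod_X_pow_sub_one_lt {n : ℕ} (hn : 0 < n) (p : F[X]) :
    (p % (X ^ n - 1)).degree < (n : WithBot ℕ) := by
  have hM : (X ^ n - 1 : F[X]).Monic := monic_X_pow_sub_C 1 hn.ne'
  have hd : (X ^ n - 1 : F[X]).degree = n := degree_X_pow_sub_C hn 1
  rw [← hd]
  exact degree_mod_lt p hM.ne_zero

/-- The map `p ↦ [p]` as a linear map. -/
noncomputable def coeffVecLin (n : ℕ) : F[X] →ₗ[F] (Fin n → F) where
  toFun := coeffVec n
  map_add' p q := by ext; simp [coeffVec, add_mod]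
  map_smul' c p := by
    ext
    simp only [coeffVec, mod_def, smul_modByMonic, coeff_smul, Pi.smul_apply, RingHom.id_apply,
      smul_eq_mul]

lemma coeffVecLin_apply (n : ℕ) (p : F[X]) : coeffVecLin n p = coeffVec n p := rfl

lemma coeffVec_eq_zero_iff {n : ℕ} (hn : 0 < n) (p : F[X]) :
    coeffVec n p = 0 ↔ X ^ n - 1 ∣ p := by
  rw [← EuclideanDomain.mod_eq_zero]
  constructor
  · intro h
    ext i
    by_cases hi : i < n
    · exact congrFun h ⟨i, hi⟩
    · refine coeff_eq_zero_of_degree_lt ((degree_mod_X_pow_sub_one_lt hn p).trans_le ?_)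
      exact_mod_cast not_lt.mp hi
  · intro h
    ext i
    simp [coeffVec, h]

lemma coeffVec_eq_iff {n : ℕ} (hn : 0 < n) (p q : F[X]) :
    coeffVec n p = coeffVec n q ↔ X ^ n - 1 ∣ p - q := by
  rw [← coeffVec_eq_zero_iff hn, ← coeffVecLin_apply, ← coeffVecLin_apply, ← coeffVecLin_apply,
    map_sub, sub_eq_zero]

lemma coeffVec_of_degree_lt {n : ℕ} (hn : 0 < n) {p : F[X]} (hp : p.degree < n) (i : Fin n) :
    coeffVec n p i = p.coeff i := by
  have hM : (X ^ n - 1 : F[X]).Monic := monic_X_pow_sub_C 1 hn.ne'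
  have hd : (X ^ n - 1 : F[X]).degree = n := degree_X_pow_sub_C hn 1
  rw [coeffVec, (mod_eq_self_iff hM.ne_zero).mpr (hp.trans_eq hd.symm)]

lemma coeffVec_X_pow {n : ℕ} (hn : 0 < n) (k : ℕ) (i : Fin n) :
    coeffVec n (X ^ k : F[X]) i = if k % n = i then 1 else 0 := by
  have h : coeffVec n (X ^ k : F[X]) = coeffVec n (X ^ (k % n)) := by
    rw [coeffVec_eq_iff hn]
    have h1 : (X ^ k - X ^ (k % n) : F[X]) = X ^ (k % n) * ((X ^ n) ^ (k / n) - 1) := by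
      rw [mul_sub, ← pow_mul, ← pow_add, Nat.mod_add_div, mul_one]
    rw [h1]
    exact Dvd.dvd.mul_left (sub_one_dvd_pow_sub_one _ _) _
  rw [h, coeffVec_of_degree_lt hn, coeff_X_pow]
  · simp only [eq_comm]
  · rw [degree_X_pow]
    exact_mod_cast Nat.mod_lt k hn

lemma coeffVec_surjective {n : ℕ} (hn : 0 < n) :
    Function.Surjective (coeffVec n : F[X] → Fin n → F) := by
  intro w
  refine ⟨((degreeLTEquiv F n).symm w : F[X]), funext fun i => ?_⟩
  rw [coeffVec_of_degree_lt hn (mem_degreeLT.mp ((degreeLTEquiv F n).symm w).2)]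
  exact congrFun ((degreeLTEquiv F n).apply_symm_apply w) i

/-- The map `(p, q) ↦ ([p], [q])` as a linear map. -/
noncomputable def wordLin (n : ℕ) : F[X] × F[X] →ₗ[F] (Fin n ⊕ Fin n → F) where
  toFun p := word n p.1 p.2
  map_add' p q := by
    ext i
    rcases i with i | i <;> simp [word, ← coeffVecLin_apply]
  map_smul' c p := by
    ext i
    rcases i with i | i <;> simp [word, ← coeffVecLin_apply]

lemma word_eq_zero_iff {n : ℕ} (hn : 0 < n) (p q : F[X]) :
    word n p q = 0 ↔ X ^ n - 1 ∣ p ∧ X ^ n - 1 ∣ q := by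
  rw [← coeffVec_eq_zero_iff hn, ← coeffVec_eq_zero_iff hn, word, ← Sum.elim_zero_zero,
    Sum.elim_eq_iff]

lemma word_eq_iff {n : ℕ} (hn : 0 < n) (p q p' q' : F[X]) :
    word n p q = word n p' q' ↔ X ^ n - 1 ∣ p - p' ∧ X ^ n - 1 ∣ q - q' := by
  rw [← coeffVec_eq_iff hn, ← coeffVec_eq_iff hn, word, word, Sum.elim_eq_iff]

lemma word_surjective {n : ℕ} (hn : 0 < n) (w : Fin n ⊕ Fin n → F) :
    ∃ p q : F[X], word n p q = w := by
  obtain ⟨p, hp⟩ := coeffVec_surjective hn (w ∘ Sum.inl)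
  obtain ⟨q, hq⟩ := coeffVec_surjective hn (w ∘ Sum.inr)
  exact ⟨p, q, by rw [word, hp, hq, Sum.elim_comp_inl_inr]⟩

/-- The encoder of a 2-generator quasi-cyclic code. -/
noncomputable def qcEncoder (n : ℕ) (g₁ g₂ ν : F[X]) : F[X] × F[X] →ₗ[F] (Fin n ⊕ Fin n → F) :=
  wordLin n ∘ₗ
    ((LinearMap.mulRight F (ν * g₁) ∘ₗ LinearMap.fst F F[X] F[X] +
        LinearMap.mulRight F g₂ ∘ₗ LinearMap.snd F F[X] F[X]).prod
      (LinearMap.mulRight F g₁ ∘ₗ LinearMap.fst F F[X] F[X] +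
        LinearMap.mulRight F (ν * g₂) ∘ₗ LinearMap.snd F F[X] F[X]))

lemma qcEncoder_apply (n : ℕ) (g₁ g₂ ν : F[X]) (a b : F[X]) :
    qcEncoder n g₁ g₂ ν (a, b) = word n (a * (ν * g₁) + b * g₂) (a * g₁ + b * (ν * g₂)) := rfl

lemma qcCode_eq_range (n : ℕ) (g₁ g₂ ν : F[X]) :
    qcCode n g₁ g₂ ν = LinearMap.range (qcEncoder n g₁ g₂ ν) := by
  apply le_antisymm
  · rw [qcCode, Submodule.span_le, Set.union_subset_iff]
    constructor
    · rintro _ ⟨a, rfl⟩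
      exact ⟨(a, 0), by simp [qcEncoder_apply]⟩
    · rintro _ ⟨b, rfl⟩
      exact ⟨(0, b), by simp [qcEncoder_apply]⟩
  · rintro _ ⟨⟨a, b⟩, rfl⟩
    have h : qcEncoder n g₁ g₂ ν (a, b) =
        word n (a * (ν * g₁)) (a * g₁) + word n (b * g₂) (b * (ν * g₂)) :=
      map_add (wordLin n) (a * (ν * g₁), a * g₁) (b * g₂, b * (ν * g₂))
    rw [h]
    exact add_mem (Submodule.subset_span (Or.inl ⟨a, rfl⟩))
      (Submodule.subset_span (Or.inr ⟨b, rfl⟩))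

lemma mem_qcCode_iff (n : ℕ) (g₁ g₂ ν : F[X]) (w : Fin n ⊕ Fin n → F) :
    w ∈ qcCode n g₁ g₂ ν ↔
      ∃ a b : F[X], word n (a * (ν * g₁) + b * g₂) (a * g₁ + b * (ν * g₂)) = w := by
  rw [qcCode_eq_range, LinearMap.mem_range, Prod.exists]
  rfl

lemma mul_div_X_pow_sub_one {n : ℕ} (hn : 0 < n) {g : F[X]} (hg : g ∣ X ^ n - 1) :
    g * ((X ^ n - 1) / g) = X ^ n - 1 := by
  have hM : (X ^ n - 1 : F[X]).Monic := monic_X_pow_sub_C 1 hn.ne'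
  exact EuclideanDomain.mul_div_cancel' (ne_zero_of_dvd_ne_zero hM.ne_zero hg) hg

lemma natDegree_div_add_natDegree {n : ℕ} (hn : 0 < n) {g : F[X]} (hg : g ∣ X ^ n - 1) :
    ((X ^ n - 1) / g).natDegree + g.natDegree = n := by
  have hM : (X ^ n - 1 : F[X]).Monic := monic_X_pow_sub_C 1 hn.ne'
  have h := mul_div_X_pow_sub_one hn hg
  have hne : g * ((X ^ n - 1) / g) ≠ 0 := by rw [h]; exact hM.ne_zero
  have hd : (X ^ n - 1 : F[X]).natDegree = n := natDegree_X_pow_sub_C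
  rw [add_comm, ← natDegree_mul (left_ne_zero_of_mul hne) (right_ne_zero_of_mul hne), h, hd]

lemma dvd_iff_X_pow_sub_one_dvd_div_mul {n : ℕ} (hn : 0 < n) {g : F[X]} (hg : g ∣ X ^ n - 1)
    (p : F[X]) : g ∣ p ↔ X ^ n - 1 ∣ (X ^ n - 1) / g * p := by
  have hM : (X ^ n - 1 : F[X]).Monic := monic_X_pow_sub_C 1 hn.ne'
  have h := mul_div_X_pow_sub_one hn hg
  have hne : (X ^ n - 1) / g ≠ 0 :=
    right_ne_zero_of_mul (a := g) (by rw [h]; exact hM.ne_zero)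
  rw [← mul_dvd_mul_iff_left hne, mul_comm _ g, h]

/-- If `ν ^ 2 - 1` is a unit modulo `X ^ n - 1`, then the words `([a ν g₁], [a g₁])` and
`([b g₂], [b ν g₂])` are independent. -/
lemma finrank_qcCode {n : ℕ} (hn : 0 < n) {g₁ g₂ ν : F[X]} (hg₁ : g₁ ∣ X ^ n - 1)
    (hg₂ : g₂ ∣ X ^ n - 1) (hν : IsCoprime (ν ^ 2 - 1) (X ^ n - 1)) :
    Module.finrank F (qcCode n g₁ g₂ ν) + g₁.natDegree + g₂.natDegree = 2 * n := by
  have hM : (X ^ n - 1 : F[X]).Monic := monic_X_pow_sub_C 1 hn.ne'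
  set h₁ := (X ^ n - 1) / g₁ with hh₁
  set h₂ := (X ^ n - 1) / g₂ with hh₂
  have e₁ := mul_div_X_pow_sub_one hn hg₁
  have e₂ := mul_div_X_pow_sub_one hn hg₂
  have d₁ := natDegree_div_add_natDegree hn hg₁
  have d₂ := natDegree_div_add_natDegree hn hg₂
  rw [← hh₁] at e₁ d₁
  rw [← hh₂] at e₂ d₂
  have hh₁0 : h₁ ≠ 0 := right_ne_zero_of_mul (e₁ ▸ hM.ne_zero)
  have hh₂0 : h₂ ≠ 0 := right_ne_zero_of_mul (e₂ ▸ hM.ne_zero)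
  have hg₁0 : g₁ ≠ 0 := left_ne_zero_of_mul (e₁ ▸ hM.ne_zero)
  have hg₂0 : g₂ ≠ 0 := left_ne_zero_of_mul (e₂ ▸ hM.ne_zero)
  -- Multipliers of `g₁` and `g₂` matter only modulo the check polynomials `h₁` and `h₂`.
  let f : degreeLT F h₁.natDegree × degreeLT F h₂.natDegree →ₗ[F] (Fin n ⊕ Fin n → F) :=
    qcEncoder n g₁ g₂ ν ∘ₗ
      (degreeLT F h₁.natDegree).subtype.prodMap (degreeLT F h₂.natDegree).subtype
  have hf : ∀ a b, f (a, b) =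
      word n (a.1 * (ν * g₁) + b.1 * g₂) (a.1 * g₁ + b.1 * (ν * g₂)) := fun _ _ => rfl
  have hinj : Function.Injective f := by
    rw [injective_iff_map_eq_zero]
    rintro ⟨⟨a, ha⟩, ⟨b, hb⟩⟩ hab
    rw [hf, word_eq_zero_iff hn] at hab
    obtain ⟨hab₁, hab₂⟩ := hab
    simp only at hab₁ hab₂
    -- Multiplying one component by `ν` and subtracting the other eliminates `b`; the symmetric
    -- combination below eliminates `a`.
    have k₁ : X ^ n - 1 ∣ (ν ^ 2 - 1) * (a * g₁) := by
      have := dvd_sub (hab₁.mul_left ν) hab₂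
      convert this using 1; ring
    have k₂ : X ^ n - 1 ∣ (ν ^ 2 - 1) * (b * g₂) := by
      have := dvd_sub (hab₂.mul_left ν) hab₁
      convert this using 1; ring
    have l₁ : h₁ ∣ a := by
      have := hν.symm.dvd_of_dvd_mul_left k₁
      rw [← e₁, mul_comm a] at this
      exact (mul_dvd_mul_iff_left hg₁0).mp this
    have l₂ : h₂ ∣ b := by
      have := hν.symm.dvd_of_dvd_mul_left k₂
      rw [← e₂, mul_comm b] at this
      exact (mul_dvd_mul_iff_left hg₂0).mp this
    rw [mem_degreeLT, ← degree_eq_natDegree hh₁0] at ha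
    rw [mem_degreeLT, ← degree_eq_natDegree hh₂0] at hb
    obtain rfl := eq_zero_of_dvd_of_degree_lt l₁ ha
    obtain rfl := eq_zero_of_dvd_of_degree_lt l₂ hb
    rfl
  have hrange : LinearMap.range f = qcCode n g₁ g₂ ν := by
    rw [qcCode_eq_range]
    apply le_antisymm
    · exact LinearMap.range_comp_le_range _ _
    · rintro _ ⟨⟨a, b⟩, rfl⟩
      refine ⟨(⟨a % h₁, ?_⟩, ⟨b % h₂, ?_⟩), ?_⟩
      · rw [mem_degreeLT, ← degree_eq_natDegree hh₁0]
        exact degree_mod_lt a hh₁0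
      · rw [mem_degreeLT, ← degree_eq_natDegree hh₂0]
        exact degree_mod_lt b hh₂0
      · rw [hf, qcEncoder_apply, word_eq_iff hn]
        have m₁ := EuclideanDomain.div_add_mod a h₁
        have m₂ := EuclideanDomain.div_add_mod b h₂
        constructor
        · refine ⟨-(a / h₁ * ν + b / h₂), ?_⟩
          linear_combination ν * g₁ * m₁ + g₂ * m₂ - a / h₁ * ν * e₁ - b / h₂ * e₂
        · refine ⟨-(a / h₁ + b / h₂ * ν), ?_⟩
          linear_combination g₁ * m₁ + ν * g₂ * m₂ - a / h₁ * e₁ - b / h₂ * ν * e₂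
  have hfin : ∀ k, Module.finrank F (degreeLT F k) = k := fun k => by
    rw [(degreeLTEquiv F k).finrank_eq, Module.finrank_fintype_fun_eq_card, Fintype.card_fin]
  have : ∀ k, Module.Finite F (degreeLT F k) := fun k =>
    Module.Finite.equiv (degreeLTEquiv F k).symm
  rw [← hrange, LinearMap.finrank_range_of_inj hinj, Module.finrank_prod, hfin, hfin]
  omega

end Cyclic

/-! ### Conjugation modulo `X ^ n - 1` and Hermitian duality of quasi-cyclic codes. -/

section Conjugation

variable {F : Type*} [Field F]

/-- The coordinate ring `F[X] / (X ^ n - 1)` of cyclic codes, as the target of the projection. -/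
noncomputable abbrev cycMk (n : ℕ) :
    F[X] →+* F[X] ⧸ Ideal.span {(X ^ n - 1 : F[X])} := Ideal.Quotient.mk _

lemma cycMk_eq_zero_iff (n : ℕ) (p : F[X]) : cycMk n p = 0 ↔ X ^ n - 1 ∣ p := by
  rw [Ideal.Quotient.eq_zero_iff_mem, Ideal.mem_span_singleton]

lemma cycMk_X_pow (n : ℕ) : cycMk n (X : F[X]) ^ n = 1 := by
  rw [← map_pow, ← sub_eq_zero, ← map_one (cycMk n), ← map_sub, cycMk_eq_zero_iff]

lemma pow_sub_eq_of_pow_eq_one {R : Type*} [CommRing R] {x : R} {n i m : ℕ} (hn : 0 < n)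
    (hx : x ^ n = 1) (hi : i ≤ m) : x ^ (m - i) = x ^ m * (x ^ (n - 1)) ^ i := by
  have h1 : x * x ^ (n - 1) = 1 := by rw [← pow_succ', Nat.sub_add_cancel hn, hx]
  conv_rhs => rw [← Nat.sub_add_cancel hi, pow_add, mul_assoc, ← mul_pow, h1, one_pow, mul_one]

variable [CharP F 2]

/-- The conjugation `∑ pᵢ Xⁱ ↦ ∑ pᵢ² X⁻ⁱ` modulo `X ^ n - 1`. -/
noncomputable def cycConj (n : ℕ) : F[X] →+* F[X] :=
  eval₂RingHom (C.comp (frobenius F 2)) (X ^ (n - 1))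

lemma cycConj_X (n : ℕ) : cycConj n (X : F[X]) = X ^ (n - 1) := by
  simp [cycConj]

lemma cycConj_C (n : ℕ) (a : F) : cycConj n (C a) = C (a ^ 2) := by
  simp [cycConj, frobenius_def]

lemma cycMk_cycConj_eq_zero (n : ℕ) {p : F[X]} (hp : cycMk n p = 0) :
    cycMk n (cycConj n p) = 0 := by
  rw [cycMk_eq_zero_iff] at hp
  obtain ⟨q, rfl⟩ := hp
  rw [map_mul, map_sub, map_one, map_pow, cycConj_X, map_mul, map_sub, map_one, ← pow_mul,
    mul_comm (n - 1), pow_mul, map_pow, map_pow, cycMk_X_pow, one_pow, sub_self, zero_mul]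

lemma cycMk_cycConj_congr (n : ℕ) {p q : F[X]} (h : cycMk n p = cycMk n q) :
    cycMk n (cycConj n p) = cycMk n (cycConj n q) := by
  rw [← sub_eq_zero, ← map_sub, ← map_sub]
  exact cycMk_cycConj_eq_zero n (by rw [map_sub, h, sub_self])

lemma cycMk_hermBar {n : ℕ} (hn : 0 < n) {p : F[X]} (hp : p.degree < n) :
    cycMk n (hermBar n p) = cycMk n (cycConj n p) := by
  have hp' : p.natDegree < n := by
    by_cases h0 : p = 0
    · simpa [h0] using hn
    · exact (natDegree_lt_iff_degree_lt h0).mpr hp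
  rw [hermBar, cycConj, coe_eval₂RingHom, eval₂_eq_sum_range' _ hp', map_sum, map_sum]
  refine Finset.sum_congr rfl fun i hi => ?_
  rw [map_mul, map_mul, map_pow, map_pow, map_pow,
    pow_sub_eq_of_pow_eq_one hn (cycMk_X_pow n) (Finset.mem_range.mp hi).le, cycMk_X_pow, one_mul]
  simp only [RingHom.comp_apply, frobenius_def, map_pow]

/-- Reversing the coefficients of the check polynomial amounts to substituting `X⁻¹` and shifting by
its degree. -/
lemma cycMk_hermPerp {n : ℕ} (hn : 0 < n) (g : F[X]) :
    cycMk n (hermPerp n g) = cycMk n X ^ ((X ^ n - 1) / g).natDegree *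
      cycMk n (cycConj n ((X ^ n - 1) / g)) := by
  rw [hermPerp, cycConj, coe_eval₂RingHom, eval₂_eq_sum_range, map_sum, map_sum, Finset.mul_sum]
  refine Finset.sum_congr rfl fun i hi => ?_
  rw [map_mul, map_mul, map_pow, map_pow, map_pow,
    pow_sub_eq_of_pow_eq_one hn (cycMk_X_pow n) (Nat.lt_succ_iff.mp (Finset.mem_range.mp hi)),
    mul_left_comm]
  simp only [RingHom.comp_apply, frobenius_def, map_pow]

/-- Both sides are additive in `p` and, since squaring is additive in characteristic 2, in `q`. For
monomials of degrees `j` and `k`, the product is a multiple of `X ^ (j - k)`, with constant term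
exactly when `j ≡ k` modulo `n`. -/
lemma sum_coeffVec_mul_sq {n : ℕ} (hn : 0 < n) (p q : F[X]) :
    ∑ i, coeffVec n p i * coeffVec n q i ^ 2 = coeffVec n (p * cycConj n q) ⟨0, hn⟩ := by
  simp only [← coeffVecLin_apply]
  induction p using Polynomial.induction_on' with
  | add p p' hp hp' => simp only [map_add, Pi.add_apply, add_mul, Finset.sum_add_distrib, hp, hp']
  | monomial j a =>
    induction q using Polynomial.induction_on' with
    | add q q' hq hq' =>
      simp only [map_add, Pi.add_apply, CharTwo.add_sq, mul_add, Finset.sum_add_distrib, hq, hq']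
    | monomial k b =>
      have h1 : cycConj n (monomial k b) = b ^ 2 • (X ^ ((n - 1) * k) : F[X]) := by
        rw [← C_mul_X_pow_eq_monomial, map_mul, map_pow, cycConj_C, cycConj_X, smul_eq_C_mul,
          ← pow_mul]
      have h2 : ∀ (k : ℕ) (b : F), monomial k b = b • (X ^ k : F[X]) := fun k b => by
        rw [← C_mul_X_pow_eq_monomial, smul_eq_C_mul]
      rw [h1, h2, h2, smul_mul_smul_comm, ← pow_add]
      simp only [map_smul, Pi.smul_apply, smul_eq_mul, coeffVecLin_apply, coeffVec_X_pow hn]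
      have h3 : (j + (n - 1) * k) % n = 0 ↔ j % n = k % n := by
        rw [← Nat.dvd_iff_mod_eq_zero]
        have h4 : j + (n - 1) * k + k = j + n * k := by
          rw [add_assoc, ← Nat.succ_mul, Nat.succ_eq_add_one, Nat.sub_add_cancel hn]
        constructor
        · rintro ⟨c, hc⟩
          have h5 : (n * c + k) % n = (j + n * k) % n := by rw [← hc, h4]
          rw [Nat.mul_add_mod, Nat.add_mul_mod_self_left] at h5
          exact h5.symm
        · intro h
          have h5 : j + (n - 1) * k ≡ k + (n - 1) * k [MOD n] := Nat.ModEq.add_right _ h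
          rw [Nat.dvd_iff_mod_eq_zero, h5, add_comm, ← Nat.succ_mul, Nat.succ_eq_add_one,
            Nat.sub_add_cancel hn, Nat.mul_mod_right]
      rw [Finset.sum_eq_single ⟨j % n, Nat.mod_lt j hn⟩]
      · simp only [h3, eq_comm (a := k % n)]
        split_ifs <;> simp
      · intro i _ hi
        have : j % n ≠ i := fun h => hi (Fin.ext h.symm)
        simp [this]
      · simp

lemma sum_word_mul_sq {n : ℕ} (hn : 0 < n) (p q p' q' : F[X]) :
    ∑ j, word n p q j * word n p' q' j ^ 2 =
      coeffVec n (p * cycConj n p' + q * cycConj n q') ⟨0, hn⟩ := by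
  simp only [Fintype.sum_sum_type, word, Sum.elim_inl, Sum.elim_inr, sum_coeffVec_mul_sq hn]
  simp only [← coeffVecLin_apply, map_add, Pi.add_apply]

lemma sum_word_mul_sq_eq_zero {n : ℕ} (hn : 0 < n) {p q p' q' : F[X]}
    (h : cycMk n p * cycMk n (cycConj n p') + cycMk n q * cycMk n (cycConj n q') = 0) :
    ∑ j, word n p q j * word n p' q' j ^ 2 = 0 := by
  rw [← map_mul, ← map_mul, ← map_add, cycMk_eq_zero_iff, ← coeffVec_eq_zero_iff hn] at h
  rw [sum_word_mul_sq hn, h, Pi.zero_apply]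

/-- The Hermitian form is nondegenerate: pairing with `X ^ i` reads off the coefficient at `i`. This
turns orthogonality to a whole code into equations in the quotient ring. -/
lemma cycMk_eq_zero_of_forall_coeffVec {n : ℕ} (hn : 0 < n) {p : F[X]}
    (h : ∀ a, coeffVec n (p * cycConj n a) ⟨0, hn⟩ = 0) : cycMk n p = 0 := by
  rw [cycMk_eq_zero_iff, ← coeffVec_eq_zero_iff hn]
  ext i
  have hi := h (X ^ (i : ℕ))
  rw [← sum_coeffVec_mul_sq hn, Finset.sum_eq_single i] at hi
  · simpa [coeffVec_X_pow hn, Nat.mod_eq_of_lt i.2] using hi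
  · intro j _ hj
    have : (i : ℕ) ≠ j := fun h => hj (Fin.ext h.symm)
    simp [coeffVec_X_pow hn, Nat.mod_eq_of_lt i.2, this]
  · simp

variable [Fintype F]

lemma cycMk_cycConj_cycConj (hF : Fintype.card F = 4) {n : ℕ} (hn : 0 < n) (p : F[X]) :
    cycMk n (cycConj n (cycConj n p)) = cycMk n p := by
  have h : ((cycMk n).comp ((cycConj n).comp (cycConj n)) : F[X] →+* _) = cycMk n := by
    refine ringHom_ext (fun a => ?_) ?_
    · simp only [RingHom.comp_apply, cycConj_C, ← pow_mul]
      rw [pow_four_eq_self hF]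
    · have h1 : cycMk n (X : F[X]) * cycMk n X ^ (n - 1) = 1 := by
        rw [← pow_succ', Nat.sub_add_cancel hn, cycMk_X_pow]
      have h2 : (cycMk n (X : F[X]) ^ (n - 1)) * (cycMk n X ^ (n - 1)) ^ (n - 1) = 1 := by
        rw [← mul_pow, h1, one_pow]
      simp only [RingHom.comp_apply, cycConj_X, map_pow]
      linear_combination cycMk n (X : F[X]) * h2 -
        (cycMk n (X : F[X]) ^ (n - 1)) ^ (n - 1) * h1
  exact RingHom.congr_fun h p

lemma cycMk_cycConj_hermPerp (hF : Fintype.card F = 4) {n : ℕ} (hn : 0 < n) (g : F[X]) :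
    cycMk n X ^ ((X ^ n - 1) / g).natDegree * cycMk n (cycConj n (hermPerp n g)) =
      cycMk n ((X ^ n - 1) / g) := by
  have h1 : cycMk n (cycConj n (hermPerp n g)) =
      (cycMk n X ^ (n - 1)) ^ ((X ^ n - 1) / g).natDegree * cycMk n ((X ^ n - 1) / g) := by
    rw [← cycMk_cycConj_cycConj hF hn ((X ^ n - 1) / g)]
    have := cycMk_hermPerp hn g
    rw [← map_pow, ← map_mul] at this
    rw [cycMk_cycConj_congr n this, map_mul, map_mul, map_pow, cycConj_X, map_pow, map_pow]
  rw [h1, ← mul_assoc, ← mul_pow, ← pow_succ', Nat.sub_add_cancel hn, cycMk_X_pow, one_pow,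
    one_mul]

/-- The conjugate of `g^⊥` is the check polynomial of `g` times a power of `X`, which is a unit
modulo `X ^ n - 1`. -/
lemma cycMk_cycConj_hermPerp_mul_eq_zero_iff (hF : Fintype.card F = 4) {n : ℕ} (hn : 0 < n)
    {g : F[X]} (hg : g ∣ X ^ n - 1) (p : F[X]) :
    cycMk n (cycConj n (hermPerp n g)) * cycMk n p = 0 ↔ g ∣ p := by
  rw [dvd_iff_X_pow_sub_one_dvd_div_mul hn hg, ← cycMk_eq_zero_iff, map_mul,
    ← cycMk_cycConj_hermPerp hF hn, mul_assoc]
  refine ⟨fun h => by rw [h, mul_zero], fun h => ?_⟩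
  have hu : IsUnit (cycMk n (X : F[X]) ^ ((X ^ n - 1) / g).natDegree) :=
    (IsUnit.of_pow_eq_one (cycMk_X_pow n) hn.ne').pow _
  exact hu.mul_right_eq_zero.mp h

lemma cycMk_cycConj_hermBar (hF : Fintype.card F = 4) {n : ℕ} (hn : 0 < n) {ν : F[X]}
    (hν : ν.degree < n) : cycMk n (cycConj n (hermBar n ν)) = cycMk n ν := by
  rw [cycMk_cycConj_congr n (cycMk_hermBar hn hν), cycMk_cycConj_cycConj hF hn]

/-- Squaring the sum exchanges the roles of `s` and `t`, because `x ^ 4 = x`. -/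
lemma sum_mul_sq_eq_zero_comm (hF : Fintype.card F = 4) {I : Type*} [Fintype I] {s t : I → F}
    (h : ∑ j, s j * t j ^ 2 = 0) : ∑ j, t j * s j ^ 2 = 0 := by
  have h1 : ∑ j, (s j * t j ^ 2) ^ 2 = 0 := by rw [← CharTwo.sum_sq, h, zero_pow two_ne_zero]
  rw [← h1]
  refine Finset.sum_congr rfl fun j _ => ?_
  linear_combination -s j ^ 2 * pow_four_eq_self hF (t j)

/-- The code `C(g₁^⊥, g₂^⊥, -ν̄)` is orthogonal to `C(g₁, g₂, ν)`. -/
lemma qcCode_orthogonal (hF : Fintype.card F = 4) {n : ℕ} (hn : 0 < n) {g₁ g₂ ν : F[X]}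
    (hg₁ : g₁ ∣ X ^ n - 1) (hg₂ : g₂ ∣ X ^ n - 1) (hν : ν.degree < n) {c s : Fin n ⊕ Fin n → F}
    (hc : c ∈ qcCode n g₁ g₂ ν)
    (hs : s ∈ qcCode n (hermPerp n g₁) (hermPerp n g₂) (-hermBar n ν)) :
    ∑ j, c j * s j ^ 2 = 0 := by
  obtain ⟨a, b, rfl⟩ := (mem_qcCode_iff _ _ _ _ _).mp hc
  obtain ⟨a', b', rfl⟩ := (mem_qcCode_iff _ _ _ _ _).mp hs
  have hb := cycMk_cycConj_hermBar hF hn hν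
  have k₁ := (cycMk_cycConj_hermPerp_mul_eq_zero_iff hF hn hg₁ g₁).mpr dvd_rfl
  have k₂ := (cycMk_cycConj_hermPerp_mul_eq_zero_iff hF hn hg₂ g₂).mpr dvd_rfl
  refine sum_word_mul_sq_eq_zero hn ?_
  simp only [map_add, map_mul, map_neg, hb]
  -- The terms that mix the two generators cancel; the others are multiples of a generator times the
  -- conjugate of its own dual generator.
  linear_combination
    cycMk n (cycConj n a') * cycMk n a * (1 - cycMk n ν ^ 2) * k₁ +
    cycMk n (cycConj n b') * cycMk n b * (1 - cycMk n ν ^ 2) * k₂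

/-- Under the divisibility conditions, the code `C(g₁^⊥, g₂^⊥, -ν̄)` is self-orthogonal. -/
lemma qcCode_hermPerp_self_orthogonal (hF : Fintype.card F = 4) {n : ℕ} (hn : 0 < n)
    {g₁ g₂ ν : F[X]} (hg₁ : g₁ ∣ X ^ n - 1) (hg₂ : g₂ ∣ X ^ n - 1) (hν : ν.degree < n)
    (h₁ : g₁ ∣ (ν * hermBar n ν + 1) * hermPerp n g₁)
    (h₂ : g₂ ∣ (ν * hermBar n ν + 1) * hermPerp n g₂)
    (h₁₂ : g₂ ∣ (ν + hermBar n ν) * hermPerp n g₁) {s t : Fin n ⊕ Fin n → F}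
    (hs : s ∈ qcCode n (hermPerp n g₁) (hermPerp n g₂) (-hermBar n ν))
    (ht : t ∈ qcCode n (hermPerp n g₁) (hermPerp n g₂) (-hermBar n ν)) :
    ∑ j, s j * t j ^ 2 = 0 := by
  obtain ⟨a, b, rfl⟩ := (mem_qcCode_iff _ _ _ _ _).mp hs
  obtain ⟨a', b', rfl⟩ := (mem_qcCode_iff _ _ _ _ _).mp ht
  have hb := cycMk_cycConj_hermBar hF hn hν
  have k₁ := (cycMk_cycConj_hermPerp_mul_eq_zero_iff hF hn hg₁ _).mpr h₁
  have k₂ := (cycMk_cycConj_hermPerp_mul_eq_zero_iff hF hn hg₂ _).mpr h₂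
  have k₂₁ := (cycMk_cycConj_hermPerp_mul_eq_zero_iff hF hn hg₂ _).mpr h₁₂
  -- One mixed divisibility condition covers both mixed terms: the second is the conjugate of the
  -- first, since `ν + ν̄` is self-conjugate.
  have k₁₂ := cycMk_cycConj_eq_zero n ((map_mul (cycMk n) _ _).trans k₂₁)
  simp only [map_add, map_mul, map_one, hb, cycMk_cycConj_cycConj hF hn,
    ← cycMk_hermBar hn hν] at k₁ k₂ k₂₁ k₁₂
  refine sum_word_mul_sq_eq_zero hn ?_
  simp only [map_add, map_mul, map_neg, hb]
  linear_combination
    cycMk n (cycConj n a') * cycMk n a * k₁ - cycMk n (cycConj n a') * cycMk n b * k₁₂ -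
    cycMk n (cycConj n b') * cycMk n a * k₂₁ + cycMk n (cycConj n b') * cycMk n b * k₂

/-- If `ν ^ 2 - 1` is a unit modulo `X ^ n - 1`, then `C(g₁, g₂, ν)` contains the Hermitian dual of
`C(g₁^⊥, g₂^⊥, -ν̄)`. -/
lemma mem_qcCode_of_orthogonal (hF : Fintype.card F = 4) {n : ℕ} (hn : 0 < n) {g₁ g₂ ν : F[X]}
    (hg₁ : g₁ ∣ X ^ n - 1) (hg₂ : g₂ ∣ X ^ n - 1) (hν : ν.degree < n)
    (hco : IsCoprime (ν ^ 2 - 1) (X ^ n - 1)) {w : Fin n ⊕ Fin n → F}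
    (hw : ∀ s ∈ qcCode n (hermPerp n g₁) (hermPerp n g₂) (-hermBar n ν),
      ∑ j, w j * s j ^ 2 = 0) : w ∈ qcCode n g₁ g₂ ν := by
  obtain ⟨u, v, rfl⟩ := word_surjective hn w
  have hb := cycMk_cycConj_hermBar hF hn hν
  have key : ∀ a b, coeffVec n (u * cycConj n (a * (-hermBar n ν * hermPerp n g₁) +
      b * hermPerp n g₂) + v * cycConj n (a * hermPerp n g₁ +
      b * (-hermBar n ν * hermPerp n g₂))) ⟨0, hn⟩ = 0 := fun a b => by
    rw [← sum_word_mul_sq hn]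
    exact hw _ ((mem_qcCode_iff _ _ _ _ _).mpr ⟨a, b, rfl⟩)
  -- Orthogonality to each generator of the auxiliary code yields one parity check on `(u, v)`.
  have l₁ : g₁ ∣ v - ν * u := by
    rw [← cycMk_cycConj_hermPerp_mul_eq_zero_iff hF hn hg₁]
    have := cycMk_eq_zero_of_forall_coeffVec hn
      (p := cycConj n (hermPerp n g₁) * (v - cycConj n (hermBar n ν) * u)) fun a => by
        rw [← key a 0]
        congr 1
        simp only [map_add, map_mul, map_neg, map_zero]
        ring
    simpa only [map_mul, map_sub, hb] using this
  have l₂ : g₂ ∣ u - ν * v := by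
    rw [← cycMk_cycConj_hermPerp_mul_eq_zero_iff hF hn hg₂]
    have := cycMk_eq_zero_of_forall_coeffVec hn
      (p := cycConj n (hermPerp n g₂) * (u - cycConj n (hermBar n ν) * v)) fun b => by
        rw [← key 0 b]
        congr 1
        simp only [map_add, map_mul, map_neg, map_zero]
        ring
    simpa only [map_mul, map_sub, hb] using this
  obtain ⟨s, hs⟩ := l₁
  obtain ⟨t, ht⟩ := l₂
  obtain ⟨ρ, κ, hρ⟩ := hco
  rw [mem_qcCode_iff]
  -- The checks combine to `(1 - ν ^ 2) u = ν g₁ s + g₂ t` and `(1 - ν ^ 2) v = g₁ s + ν g₂ t`;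
  -- modulo `X ^ n - 1`, `-ρ` inverts `1 - ν ^ 2`.
  refine ⟨-ρ * s, -ρ * t, (word_eq_iff hn _ _ _ _).mpr ⟨⟨-κ * u, ?_⟩, ⟨-κ * v, ?_⟩⟩⟩
  · linear_combination ρ * ν * hs + ρ * ht + u * hρ
  · linear_combination ρ * hs + ρ * ν * ht + v * hρ

end Conjugation

/-! ### Assembly of the main theorem. -/

theorem theorem3 {F : Type*} [Field F] [Fintype F] [DecidableEq F] (hF : Fintype.card F = 4)
    (n : ℕ) (hn : 0 < n) (g₁ g₂ ν : F[X])
    (hg₁ : g₁ ∣ X ^ n - 1) (hg₂ : g₂ ∣ X ^ n - 1) (hν : ν.degree < n)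
    (hdim : IsCoprime (ν - 1) (X ^ n - 1) ∨
      (Module.finrank F (qcCode n g₁ g₂ ν) + g₁.natDegree + g₂.natDegree = 2 * n ∧
        Module.finrank F (qcCode n (hermPerp n g₁) (hermPerp n g₂) (-hermBar n ν)) =
          g₁.natDegree + g₂.natDegree))
    (h₁ : g₁ ∣ (ν * hermBar n ν + 1) * hermPerp n g₁)
    (h₂ : g₂ ∣ (ν * hermBar n ν + 1) * hermPerp n g₂)
    (h₁₂ : g₂ ∣ (ν + hermBar n ν) * hermPerp n g₁) :
    2 * g₁.natDegree + 2 * g₂.natDegree ≤ 2 * n ∧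
      ∃ d : ℕ, IsLeast {w : ℕ | ∃ c ∈ qcCode n g₁ g₂ ν, c ≠ 0 ∧ hammingNorm c = w} d ∧
        ∃ Q : Submodule ℂ (QubitSpace (2 * n)),
          IsPureQuantumCode Q (2 * n - 2 * g₁.natDegree - 2 * g₂.natDegree) d := by
  have := charP_two_of_card_eq_four hF
  set C := qcCode n g₁ g₂ ν
  set S := qcCode n (hermPerp n g₁) (hermPerp n g₂) (-hermBar n ν)
  have hI : Fintype.card (Fin n ⊕ Fin n) = 2 * n := by
    rw [Fintype.card_sum, Fintype.card_fin, two_mul]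
  have hSS : ∀ s ∈ S, ∀ t ∈ S, ∑ j, s j * t j ^ 2 = 0 := fun s hs t ht =>
    qcCode_hermPerp_self_orthogonal hF hn hg₁ hg₂ hν h₁ h₂ h₁₂ hs ht
  have hSC : ∀ s ∈ S, ∀ c ∈ C, ∑ j, s j * c j ^ 2 = 0 := fun s hs c hc =>
    sum_mul_sq_eq_zero_comm hF (qcCode_orthogonal hF hn hg₁ hg₂ hν hc hs)
  have hdual := hermitian_dual_iff_finrank hF hSC
  rw [hI] at hdual
  obtain ⟨hC, hdimC, hdimS⟩ :
      (∀ w : Fin n ⊕ Fin n → F, (∀ s ∈ S, ∑ j, s j * w j ^ 2 = 0) → w ∈ C) ∧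
      Module.finrank F C + g₁.natDegree + g₂.natDegree = 2 * n ∧
      Module.finrank F S = g₁.natDegree + g₂.natDegree := by
    rcases hdim with hco | ⟨hdimC, hdimS⟩
    · have hco' : IsCoprime (ν ^ 2 - 1) (X ^ n - 1) := by
        have h : ν ^ 2 - 1 = (ν - 1) ^ 2 := by
          rw [CharTwo.sub_eq_add, CharTwo.sub_eq_add, CharTwo.add_sq, one_pow]
        rw [h]
        exact hco.pow_left
      have hC : ∀ w : Fin n ⊕ Fin n → F, (∀ s ∈ S, ∑ j, s j * w j ^ 2 = 0) → w ∈ C := fun w hw =>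
        mem_qcCode_of_orthogonal hF hn hg₁ hg₂ hν hco' fun s hs =>
          sum_mul_sq_eq_zero_comm hF (hw s hs)
      have h1 := hdual.mp hC
      have h2 : Module.finrank F C + g₁.natDegree + g₂.natDegree = 2 * n :=
        finrank_qcCode hn hg₁ hg₂ hco'
      exact ⟨hC, h2, by omega⟩
    · exact ⟨hdual.mpr (by omega), hdimC, hdimS⟩
  -- Self-orthogonality places `S` inside its dual `C`. The resulting degree bound also makes the
  -- truncated subtraction in the exponent exact.
  have hle : Module.finrank F S ≤ Module.finrank F C :=
    Submodule.finrank_mono fun s hs => hC s fun t ht => hSS t ht s hs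
  refine ⟨by omega, ?_⟩
  have hne : {w : ℕ | ∃ c ∈ C, c ≠ 0 ∧ hammingNorm c = w}.Nonempty := by
    -- If `C` were zero, so would be `S`; both degrees would then vanish and `C` would have
    -- dimension `2 * n > 0`.
    have hC0 : C ≠ ⊥ := by
      intro h
      rw [h, finrank_bot] at hle hdimC
      omega
    obtain ⟨c, hc, hc0⟩ := Submodule.exists_mem_ne_zero_of_ne_bot hC0
    exact ⟨_, c, hc, hc0, rfl⟩
  have hleast := isLeast_csInf hne
  exact ⟨_, hleast, exists_isPureQuantumCode hF hI S C hSS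
    (fun w => ⟨fun hw s hs => hSC s hs w hw, hC w⟩) (by omega) hleast⟩
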